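/- \textbf{Setting.} For a unit vector $|\psi\rangle\in\mathbb{C}^d\otimes\mathbb{C}^d$ let $\rho$ be its reduced density matrix on the first register and let $H_2(|\psi\rangle)=-\log \mathrm{Tr}(\rho^2)$ be its Rényi 2-entropy ($\log$ is the natural logarithm). In the \emph{Entanglement Entropy problem} with parameters $a<b\le\log d$, one is given oracle access to the unitary $U=I-2|\psi\rangle\langle\psi|$, where $|\psi\rangle\in\mathbb{C}^d\otimes\mathbb{C}^d$ is an unknown unit vector promised to satisfy either $H_2(|\psi\rangle)\le a$ (low entropy) or $H_2(|\psi\rangle)\ge b$ (high entropy), and has to decide which is the case. A \emph{$T$-query algorithm} acts on a control qubit, the query register $\mathbb{C}^d\otimes\mathbb{C}^d$ and an ancilla register of arbitrary finite dimension. It starts in a fixed basis state, applies fixed unitaries $A_0,A_1,\dots,A_T$ that do not depend on $U$, with one query, either controlled-$U$ or controlled-$U^*$, between each $A_{t-1}$ and $A_t$ ($T$ queries in total), and finally measures in the standard basis and accepts if the outcome lies in a fixed set. It is a \emph{tester} for the problem if it accepts with probability at least $2/3$ on all instances of one of the two cases and with probability at most $1/3$ on all instances of the other. \textbf{Theorem.}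 There is a universal constant $c>0$ such that for every positive integer $d$ and all real numbers $a,b$ with $a\ge 5$ and $a<b\le\log d$, every $T$-query tester for the Entanglement Entropy problem with parameters $a,b$ satisfies $T\ge c\,\exp(a/4)$. That is, any tester must make $\Omega(\exp(a/4))$ queries to distinguish between the low and the high entropy cases. -/

import Mathlib

open scoped Matrix

noncomputable section

namespace UnitaryTesting

/-- A unitary property on the space with orthonormal basis indexed by `ι`: disjoint sets of
yes-instances and no-instances. -/
structure UnitaryProperty (ι : Type*) [Fintype ι] [DecidableEq ι] where
  yes : Set (Matrix.unitaryGroup ι ℂ)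
  no : Set (Matrix.unitaryGroup ι ℂ)
  disjoint : Disjoint yes no

/-- The same decision problem with the roles of yes- and no-instances exchanged. -/
def UnitaryProperty.swap {ι : Type*} [Fintype ι] [DecidableEq ι] (P : UnitaryProperty ι) :
    UnitaryProperty ι where
  yes := P.no
  no := P.yes
  disjoint := P.disjoint.symm

/-- The controlled operation `cU = |0⟩⟨0| ⊗ I ⊗ I + |1⟩⟨1| ⊗ U ⊗ I` on
(control qubit) ⊗ (query register) ⊗ (ancilla register). -/
def controlled {ι κ : Type*} [DecidableEq ι] [DecidableEq κ] (U : Matrix ι ι ℂ) :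
    Matrix (Bool × ι × κ) (Bool × ι × κ) ℂ :=
  Matrix.of fun x y =>
    if x.1 = y.1 ∧ x.2.2 = y.2.2 then
      (if x.1 = true then U x.2.1 y.2.1 else (1 : Matrix ι ι ℂ) x.2.1 y.2.1)
    else 0

/-- A quantum algorithm that makes `T` queries to a unitary oracle acting on the register `ι`.
It starts in a fixed computational basis state, applies fixed unitaries `A₀, …, A_T`
interleaved with `T` controlled queries, each to the oracle or to its inverse, then measures in
the computational basis and accepts if the outcome lies in `accept`. -/
structure QueryAlgorithm (ι : Type*) [Fintype ι] [DecidableEq ι] (T : ℕ) where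
  /-- dimension of the ancilla register -/
  anc : ℕ
  init : Bool × ι × Fin anc
  gate : Fin (T + 1) → Matrix.unitaryGroup (Bool × ι × Fin anc) ℂ
  /-- whether the `t`-th query is to the inverse of the oracle -/
  inverse : Fin T → Bool
  accept : Finset (Bool × ι × Fin anc)

namespace QueryAlgorithm

variable {ι : Type*} [Fintype ι] [DecidableEq ι] {T : ℕ}

/-- The state of the algorithm on oracle `U` just after the gate `A_t`. -/
def state (A : QueryAlgorithm ι T) (U : Matrix.unitaryGroup ι ℂ) :
    Fin (T + 1) → (Bool × ι × Fin A.anc → ℂ) :=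
  Fin.induction (motive := fun _ => Bool × ι × Fin A.anc → ℂ)
    ((A.gate 0 : Matrix _ _ ℂ) *ᵥ Pi.single A.init 1)
    (fun t v => (A.gate t.succ : Matrix _ _ ℂ) *ᵥ
      (controlled (if A.inverse t = true then ((U⁻¹ : Matrix.unitaryGroup ι ℂ) : Matrix ι ι ℂ)
        else (U : Matrix ι ι ℂ)) *ᵥ v))

/-- The probability that the algorithm accepts on oracle `U`. -/
def acceptProb (A : QueryAlgorithm ι T) (U : Matrix.unitaryGroup ι ℂ) : ℝ :=
  ∑ x ∈ A.accept, ‖A.state U (Fin.last T) x‖ ^ 2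

/-- The algorithm is a tester for the property `P`. -/
def IsTester (A : QueryAlgorithm ι T) (P : UnitaryProperty ι) : Prop :=
  (∀ U ∈ P.yes, 2 / 3 ≤ A.acceptProb U) ∧ (∀ U ∈ P.no, A.acceptProb U ≤ 1 / 3)

end QueryAlgorithm

/-- The operator `|ψ⟩⟨ψ|`. -/
def ketbra {ι : Type*} [Fintype ι] (ψ : EuclideanSpace ℂ ι) : Matrix ι ι ℂ :=
  Matrix.vecMulVec ψ.ofLp (star ψ.ofLp)

theorem ketbra_conjTranspose {ι : Type*} [Fintype ι] (ψ : EuclideanSpace ℂ ι) :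
    (ketbra ψ)ᴴ = ketbra ψ := by
  simp [ketbra, Matrix.conjTranspose_vecMulVec]

theorem ketbra_mul_self {ι : Type*} [Fintype ι] (ψ : EuclideanSpace ℂ ι) (hψ : ‖ψ‖ = 1) :
    ketbra ψ * ketbra ψ = ketbra ψ := by
  have h : star ψ.ofLp ⬝ᵥ ψ.ofLp = 1 := by
    have h1 : inner ℂ ψ ψ = (1 : ℂ) := by
      rw [inner_self_eq_norm_sq_to_K, hψ]; simp
    rw [← h1, EuclideanSpace.inner_eq_star_dotProduct, dotProduct_comm]
  rw [ketbra, Matrix.vecMulVec_mul_vecMulVec, h, one_smul]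

/-- The reflection `I - 2|ψ⟩⟨ψ|` about a unit vector `ψ`, as a unitary. -/
def reflection {ι : Type*} [Fintype ι] [DecidableEq ι] (ψ : EuclideanSpace ℂ ι)
    (hψ : ‖ψ‖ = 1) : Matrix.unitaryGroup ι ℂ :=
  ⟨1 - (2 : ℂ) • ketbra ψ, by
    rw [Matrix.mem_unitaryGroup_iff, Matrix.star_eq_conjTranspose, Matrix.conjTranspose_sub,
      Matrix.conjTranspose_smul, ketbra_conjTranspose, Matrix.conjTranspose_one,
      star_ofNat, sub_mul, mul_sub, mul_sub, smul_mul_smul_comm, ketbra_mul_self ψ hψ]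
    simp only [one_mul, mul_one]
    module⟩

/-- The partial trace over the second tensor factor. -/
def partialTraceSnd {m n : Type*} [Fintype n] (M : Matrix (m × n) (m × n) ℂ) : Matrix m m ℂ :=
  Matrix.of fun i i' => ∑ j, M (i, j) (i', j)

/-- The reduced density matrix of `ψ` on the first register. -/
def reducedDensity {d : ℕ} (ψ : EuclideanSpace ℂ (Fin d × Fin d)) : Matrix (Fin d) (Fin d) ℂ :=
  partialTraceSnd (ketbra ψ)

/-- The Rényi 2-entropy `H₂(ψ) = -log Tr(ρ²)` (natural logarithm), where `ρ` is the reduced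
density matrix of `ψ`; the trace is a real number. -/
def renyiTwo {d : ℕ} (ψ : EuclideanSpace ℂ (Fin d × Fin d)) : ℝ :=
  -Real.log (Matrix.trace (reducedDensity ψ ^ 2)).re

theorem renyiTwo_eq_of_reflection_eq {d : ℕ} {ψ φ : EuclideanSpace ℂ (Fin d × Fin d)}
    {hψ : ‖ψ‖ = 1} {hφ : ‖φ‖ = 1} (h : reflection ψ hψ = reflection φ hφ) :
    renyiTwo ψ = renyiTwo φ := by
  have h1 : (1 : Matrix _ _ ℂ) - (2 : ℂ) • ketbra ψ = 1 - (2 : ℂ) • ketbra φ :=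
    congrArg Subtype.val h
  have h2 : ketbra ψ = ketbra φ :=
    smul_right_injective _ (two_ne_zero' ℂ) (sub_right_injective h1)
  rw [renyiTwo, renyiTwo, reducedDensity, reducedDensity, h2]

/-- The Entanglement Entropy problem with parameters `a < b` for states in `ℂ^d ⊗ ℂ^d`:
the yes-instances are the low entropy reflections, the no-instances the high entropy ones. -/
def entanglementEntropyProblem (d : ℕ) (a b : ℝ) (hab : a < b) :
    UnitaryProperty (Fin d × Fin d) where
  yes := {U | ∃ (ψ : EuclideanSpace ℂ (Fin d × Fin d)) (hψ : ‖ψ‖ = 1),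
    renyiTwo ψ ≤ a ∧ U = reflection ψ hψ}
  no := {U | ∃ (ψ : EuclideanSpace ℂ (Fin d × Fin d)) (hψ : ‖ψ‖ = 1),
    b ≤ renyiTwo ψ ∧ U = reflection ψ hψ}
  disjoint := by
    rw [Set.disjoint_left]
    rintro U ⟨ψ, hψ, h1, rfl⟩ ⟨φ, hφ, h2, h3⟩
    have := renyiTwo_eq_of_reflection_eq h3
    linarith

end UnitaryTesting

end

/-! One hard pair of instances suffices. The maximally entangled state has all Schmidt coefficients
`1/√d` and entropy `log d`. Raise one coefficient to `t = exp (-a/4)` and flatten the others: the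
purity is at least `t ^ 4 = exp (-a)`, so the entropy drops to at most `a`, yet the state moves only
by `O(t)` (`exists_low_high_pair`). The two reflections are then `O(t)` apart in operator norm
(`norm_reflection_sub_le`), and by the hybrid argument (`QueryAlgorithm.acceptProb_sub_le`) `T`
queries produce a bias of `O(T t)`. A bias of `1/3` forces `T` to be of order at least `1/t`. -/

noncomputable section

namespace UnitaryTesting

/-! ### Hybrid argument for controlled queries. -/

section Hybrid

open scoped Matrix.Norms.L2Operator

variable {ι : Type*} [Fintype ι] [DecidableEq ι]

theorem controlled_mulVec {κ : Type*} [Fintype κ] [DecidableEq κ] (U : Matrix ι ι ℂ)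
    (v : Bool × ι × κ → ℂ) (b : Bool) (i : ι) (k : κ) :
    (controlled U *ᵥ v) (b, i, k) =
      if b = true then (U *ᵥ fun j => v (b, j, k)) i else v (b, i, k) := by
  have h : ∀ y : Bool × ι × κ, controlled U (b, i, k) y * v y =
      if b = y.1 then (if k = y.2.2 then
        (if b = true then U i y.2.1 else (1 : Matrix ι ι ℂ) i y.2.1) * v y else 0) else 0 := by
    intro y
    by_cases h1 : b = y.1 <;> by_cases h2 : k = y.2.2 <;> simp [controlled, h1, h2]
  simp only [Matrix.mulVec, dotProduct, h, Fintype.sum_prod_type]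
  cases b <;> simp [Matrix.one_apply]

theorem norm_sq_eq_sum_slices {m κ : Type*} [Fintype m] [Fintype κ] (v : Bool × m × κ → ℂ) :
    ‖WithLp.toLp 2 v‖ ^ 2 =
      ∑ k, (‖WithLp.toLp 2 fun i => v (true, i, k)‖ ^ 2 +
        ‖WithLp.toLp 2 fun i => v (false, i, k)‖ ^ 2) := by
  simp only [EuclideanSpace.norm_sq_eq, Fintype.sum_prod_type, Fintype.sum_bool,
    Finset.sum_add_distrib]
  congr 1 <;> exact Finset.sum_comm

theorem norm_unitary_mulVec {U : Matrix ι ι ℂ} (hU : U ∈ Matrix.unitaryGroup ι ℂ) (v : ι → ℂ) :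
    ‖WithLp.toLp 2 (U *ᵥ v)‖ = ‖WithLp.toLp 2 v‖ := by
  have h : ‖WithLp.toLp 2 (U *ᵥ v)‖ ^ 2 = ‖WithLp.toLp 2 v‖ ^ 2 := by
    have hU' : Uᴴ * U = 1 := Matrix.mem_unitaryGroup_iff'.1 hU
    have key : star (U *ᵥ v) ⬝ᵥ (U *ᵥ v) = star v ⬝ᵥ v := by
      rw [Matrix.star_mulVec, Matrix.dotProduct_mulVec, Matrix.vecMul_vecMul, hU',
        Matrix.vecMul_one]
    have e : ∀ w : ι → ℂ, ((‖WithLp.toLp 2 w‖ ^ 2 : ℝ) : ℂ) = star w ⬝ᵥ w := by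
      intro w
      rw [EuclideanSpace.norm_sq_eq]
      push_cast
      refine Finset.sum_congr rfl fun i _ => ?_
      simp [Complex.conj_mul']
    exact_mod_cast (e _).trans (key.trans (e _).symm)
  exact (sq_eq_sq₀ (norm_nonneg _) (norm_nonneg _)).1 h

theorem norm_controlled_unitary_mulVec {κ : Type*} [Fintype κ] [DecidableEq κ]
    {U : Matrix ι ι ℂ} (hU : U ∈ Matrix.unitaryGroup ι ℂ) (v : Bool × ι × κ → ℂ) :
    ‖WithLp.toLp 2 (controlled U *ᵥ v)‖ = ‖WithLp.toLp 2 v‖ := by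
  refine (sq_eq_sq₀ (norm_nonneg _) (norm_nonneg _)).1 ?_
  rw [norm_sq_eq_sum_slices, norm_sq_eq_sum_slices v]
  refine Finset.sum_congr rfl fun k _ => ?_
  simp only [controlled_mulVec, if_true, Bool.false_eq_true, if_false]
  rw [norm_unitary_mulVec hU]

/-- With the control off both operators act trivially and cancel. With it on, `U - V` acts on the
query register separately for each ancilla value. -/
theorem norm_controlled_sub_mulVec_le {κ : Type*} [Fintype κ] [DecidableEq κ]
    (U V : Matrix ι ι ℂ) (v : Bool × ι × κ → ℂ) :
    ‖WithLp.toLp 2 (controlled U *ᵥ v - controlled V *ᵥ v)‖ ≤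
      ‖U - V‖ * ‖WithLp.toLp 2 v‖ := by
  refine (sq_le_sq₀ (norm_nonneg _) (by positivity)).1 ?_
  rw [mul_pow, norm_sq_eq_sum_slices, norm_sq_eq_sum_slices v, Finset.mul_sum]
  refine Finset.sum_le_sum fun k _ => ?_
  have h1 : (fun i => (controlled U *ᵥ v - controlled V *ᵥ v) (true, i, k)) =
      (U - V) *ᵥ fun j => v (true, j, k) := by
    ext i
    simp [controlled_mulVec, Matrix.sub_mulVec]
  have h2 : (fun i => (controlled U *ᵥ v - controlled V *ᵥ v) (false, i, k)) = 0 := by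
    ext i
    simp [controlled_mulVec]
  rw [h1, h2]
  have h3 : ‖WithLp.toLp 2 ((U - V) *ᵥ fun j => v (true, j, k))‖ ≤
      ‖U - V‖ * ‖WithLp.toLp 2 fun j => v (true, j, k)‖ :=
    Matrix.l2_opNorm_mulVec (U - V) (WithLp.toLp 2 fun j => v (true, j, k))
  have h4 := pow_le_pow_left₀ (norm_nonneg _) h3 2
  have h5 : 0 ≤ ‖U - V‖ ^ 2 * ‖WithLp.toLp 2 fun i => v (false, i, k)‖ ^ 2 := by positivity
  simp only [WithLp.toLp_zero, norm_zero]
  linarith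

variable {T : ℕ}

namespace QueryAlgorithm

/-- The matrix of the oracle that the `t`-th query uses. -/
def query (A : QueryAlgorithm ι T) (U : Matrix.unitaryGroup ι ℂ) (t : Fin T) : Matrix ι ι ℂ :=
  if A.inverse t = true then ((U⁻¹ : Matrix.unitaryGroup ι ℂ) : Matrix ι ι ℂ)
  else (U : Matrix ι ι ℂ)

theorem query_mem (A : QueryAlgorithm ι T) (U : Matrix.unitaryGroup ι ℂ) (t : Fin T) :
    A.query U t ∈ Matrix.unitaryGroup ι ℂ := by
  unfold query
  split_ifs
  · exact (U⁻¹).2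
  · exact U.2

/-- The adjoint preserves the operator norm, so inverse queries separate the oracles no better than
forward ones. -/
theorem norm_query_sub (A : QueryAlgorithm ι T) (U V : Matrix.unitaryGroup ι ℂ) (t : Fin T) :
    ‖A.query U t - A.query V t‖ = ‖(U : Matrix ι ι ℂ) - V‖ := by
  unfold query
  split_ifs
  · rw [Matrix.UnitaryGroup.inv_val, Matrix.UnitaryGroup.inv_val, ← star_sub,
      Matrix.star_eq_conjTranspose, Matrix.l2_opNorm_conjTranspose]
  · rfl

theorem state_zero (A : QueryAlgorithm ι T) (U : Matrix.unitaryGroup ι ℂ) :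
    A.state U 0 = (A.gate 0 : Matrix _ _ ℂ) *ᵥ Pi.single A.init 1 := rfl

theorem state_succ (A : QueryAlgorithm ι T) (U : Matrix.unitaryGroup ι ℂ) (t : Fin T) :
    A.state U t.succ = (A.gate t.succ : Matrix _ _ ℂ) *ᵥ
      (controlled (A.query U t) *ᵥ A.state U t.castSucc) := rfl

theorem norm_state (A : QueryAlgorithm ι T) (U : Matrix.unitaryGroup ι ℂ) (t : Fin (T + 1)) :
    ‖WithLp.toLp 2 (A.state U t)‖ = 1 := by
  induction t using Fin.induction with
  | zero =>
    rw [state_zero, norm_unitary_mulVec (A.gate 0).2]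
    simp
  | succ t ih =>
    rw [state_succ, norm_unitary_mulVec (A.gate t.succ).2,
      norm_controlled_unitary_mulVec (A.query_mem U t), ih]

theorem norm_state_sub_le (A : QueryAlgorithm ι T) (U V : Matrix.unitaryGroup ι ℂ)
    (t : Fin (T + 1)) :
    ‖WithLp.toLp 2 (A.state U t - A.state V t)‖ ≤ t * ‖(U : Matrix ι ι ℂ) - V‖ := by
  induction t using Fin.induction with
  | zero => simp [state_zero]
  | succ t ih =>
    -- Split into the same query on two states, which preserves the accumulated distance, and two
    -- queries on one unit state, which adds at most `‖U - V‖`.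
    have h : controlled (A.query U t) *ᵥ A.state U t.castSucc -
          controlled (A.query V t) *ᵥ A.state V t.castSucc =
        controlled (A.query U t) *ᵥ (A.state U t.castSucc - A.state V t.castSucc) +
          (controlled (A.query U t) *ᵥ A.state V t.castSucc -
            controlled (A.query V t) *ᵥ A.state V t.castSucc) := by
      rw [Matrix.mulVec_sub]; abel
    have h1 := norm_controlled_sub_mulVec_le (A.query U t) (A.query V t) (A.state V t.castSucc)
    rw [norm_state, mul_one, norm_query_sub] at h1
    rw [state_succ, state_succ, ← Matrix.mulVec_sub, norm_unitary_mulVec (A.gate t.succ).2, h,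
      WithLp.toLp_add]
    refine (norm_add_le _ _).trans ?_
    rw [norm_controlled_unitary_mulVec (A.query_mem U t)]
    simp only [Fin.val_succ, Fin.val_castSucc] at ih ⊢
    push_cast
    linarith

end QueryAlgorithm

/-- For `P` the coordinate projection onto `s`, factor `‖P v‖² - ‖P w‖²` as a difference of squares:
the sum of the norms is at most 2 and `P` is a contraction. -/
theorem sum_norm_sq_sub_le {X : Type*} [Fintype X] (s : Finset X) (v w : X → ℂ)
    (hv : ‖WithLp.toLp 2 v‖ = 1) (hw : ‖WithLp.toLp 2 w‖ = 1) :
    ∑ x ∈ s, ‖v x‖ ^ 2 - ∑ x ∈ s, ‖w x‖ ^ 2 ≤ 2 * ‖WithLp.toLp 2 (v - w)‖ := by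
  classical
  let P : (X → ℂ) → EuclideanSpace ℂ X := fun u => WithLp.toLp 2 fun x => if x ∈ s then u x else 0
  have hP : ∀ u, ‖P u‖ ^ 2 = ∑ x ∈ s, ‖u x‖ ^ 2 := by
    intro u
    simp only [P, EuclideanSpace.norm_sq_eq, apply_ite norm, norm_zero, ite_pow]
    simp
  have hle : ∀ u, ‖P u‖ ≤ ‖WithLp.toLp 2 u‖ := by
    intro u
    refine (sq_le_sq₀ (norm_nonneg _) (norm_nonneg _)).1 ?_
    rw [hP, EuclideanSpace.norm_sq_eq]
    exact Finset.sum_le_sum_of_subset_of_nonneg (Finset.subset_univ s) fun _ _ _ => by positivity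
  have hsub : P v - P w = P (v - w) := by
    ext x
    by_cases hx : x ∈ s <;> simp [P, hx]
  have h1 : ‖P v‖ - ‖P w‖ ≤ ‖WithLp.toLp 2 (v - w)‖ :=
    (norm_sub_norm_le _ _).trans (hsub ▸ hle _)
  have h2 := hle v
  have h3 := hle w
  rw [hv] at h2
  rw [hw] at h3
  rw [← hP, ← hP]
  nlinarith [norm_nonneg (P v), norm_nonneg (P w), norm_nonneg (WithLp.toLp 2 (v - w))]

/-- Hybrid argument: `T` queries distinguish `U` from `V` with bias at most `2 T ‖U - V‖`. -/
theorem QueryAlgorithm.acceptProb_sub_le (A : QueryAlgorithm ι T)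
    (U V : Matrix.unitaryGroup ι ℂ) :
    A.acceptProb U - A.acceptProb V ≤ 2 * (T * ‖(U : Matrix ι ι ℂ) - V‖) :=
  (sum_norm_sq_sub_le A.accept _ _ (A.norm_state U _) (A.norm_state V _)).trans
    (by simpa using A.norm_state_sub_le U V (Fin.last T))

theorem ketbra_mulVec {m : Type*} [Fintype m] (ψ v : EuclideanSpace ℂ m) :
    WithLp.toLp 2 (ketbra ψ *ᵥ v.ofLp) = inner ℂ ψ v • ψ := by
  ext i
  simp only [ketbra, Matrix.vecMulVec_mulVec, EuclideanSpace.inner_eq_star_dotProduct,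
    PiLp.smul_apply, Pi.smul_apply, MulOpposite.smul_eq_mul_unop, MulOpposite.unop_op, smul_eq_mul]
  rw [mul_comm, dotProduct_comm]

theorem norm_reflection_sub_le (ψ φ : EuclideanSpace ℂ ι) (hψ : ‖ψ‖ = 1) (hφ : ‖φ‖ = 1) :
    ‖(reflection ψ hψ : Matrix ι ι ℂ) - reflection φ hφ‖ ≤ 4 * ‖ψ - φ‖ := by
  have h0 : (reflection ψ hψ : Matrix ι ι ℂ) - reflection φ hφ =
      (2 : ℂ) • (ketbra φ - ketbra ψ) := by
    simp only [reflection, smul_sub]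
    abel
  have h1 : ‖ketbra φ - ketbra ψ‖ ≤ 2 * ‖ψ - φ‖ := by
    rw [Matrix.l2_opNorm_def]
    refine ContinuousLinearMap.opNorm_le_bound _ (by positivity) fun v => ?_
    -- `|φ⟩⟨φ| - |ψ⟩⟨ψ| = |φ⟩⟨φ - ψ| + |φ - ψ⟩⟨ψ|`; each summand has norm at most `‖ψ - φ‖`.
    have h2 : Matrix.toEuclideanLin (ketbra φ - ketbra ψ) v =
        inner ℂ (φ - ψ) v • φ + inner ℂ ψ v • (φ - ψ) := by
      have : Matrix.toEuclideanLin (ketbra φ - ketbra ψ) v =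
          WithLp.toLp 2 (ketbra φ *ᵥ v.ofLp) - WithLp.toLp 2 (ketbra ψ *ᵥ v.ofLp) := by
        rw [← WithLp.toLp_sub, ← Matrix.sub_mulVec]; rfl
      rw [this, ketbra_mulVec, ketbra_mulVec, inner_sub_left]
      module
    change ‖Matrix.toEuclideanLin (ketbra φ - ketbra ψ) v‖ ≤ _
    rw [h2]
    refine (norm_add_le _ _).trans ?_
    rw [norm_smul, norm_smul, hφ]
    have h3 := norm_inner_le_norm (𝕜 := ℂ) (φ - ψ) v
    have h4 := norm_inner_le_norm (𝕜 := ℂ) ψ v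
    rw [hψ, one_mul] at h4
    rw [norm_sub_rev φ ψ] at h3 ⊢
    nlinarith [norm_nonneg (ψ - φ)]
  rw [h0, norm_smul]
  simp only [Complex.norm_ofNat]
  linarith

end Hybrid

/-! ### States with prescribed Schmidt coefficients. -/

section Schmidt

variable {d : ℕ}

/-- The vector `∑ᵢ xᵢ |i⟩|i⟩`. -/
def diagonalState (x : Fin d → ℝ) : EuclideanSpace ℂ (Fin d × Fin d) :=
  WithLp.toLp 2 fun p => if p.1 = p.2 then (x p.1 : ℂ) else 0

theorem diagonalState_sub (x y : Fin d → ℝ) :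
    diagonalState x - diagonalState y = diagonalState (x - y) := by
  ext p
  by_cases h : p.1 = p.2 <;> simp [diagonalState, h]

theorem norm_sq_diagonalState (x : Fin d → ℝ) : ‖diagonalState x‖ ^ 2 = ∑ i, x i ^ 2 := by
  simp [diagonalState, EuclideanSpace.norm_sq_eq, Fintype.sum_prod_type, apply_ite norm, ite_pow]

theorem reducedDensity_diagonalState (x : Fin d → ℝ) :
    reducedDensity (diagonalState x) = Matrix.diagonal fun i => ((x i ^ 2 : ℝ) : ℂ) := by
  ext i j
  by_cases h : i = j
  · subst h
    simp [reducedDensity, partialTraceSnd, ketbra, diagonalState, Matrix.vecMulVec_apply,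
      sq, apply_ite (starRingEnd ℂ)]
  · simp [reducedDensity, partialTraceSnd, ketbra, diagonalState, Matrix.vecMulVec_apply, h,
      apply_ite (starRingEnd ℂ)]

/-- The fourth powers are the source of the exponent `a/4`: a single coefficient `exp (-a/4)`
already gives purity `exp (-a)`. -/
theorem renyiTwo_diagonalState (x : Fin d → ℝ) :
    renyiTwo (diagonalState x) = -Real.log (∑ i, x i ^ 4) := by
  rw [renyiTwo, reducedDensity_diagonalState, Matrix.diagonal_pow, Matrix.trace_diagonal,
    Complex.re_sum]
  congr 2
  refine Finset.sum_congr rfl fun i _ => ?_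
  rw [Pi.pow_apply, ← Complex.ofReal_pow, Complex.ofReal_re]
  ring

theorem renyiTwo_maximallyEntangled (hd : 0 < d) :
    renyiTwo (diagonalState fun _ : Fin d => (√d)⁻¹) = Real.log d := by
  have hd' : (0 : ℝ) < d := by exact_mod_cast hd
  have h : ((√(d : ℝ))⁻¹) ^ 4 = (d : ℝ)⁻¹ * (d : ℝ)⁻¹ := by
    rw [inv_pow, show (√(d : ℝ)) ^ 4 = (√(d : ℝ) ^ 2) ^ 2 by ring, Real.sq_sqrt hd'.le]
    field_simp
  rw [renyiTwo_diagonalState]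
  simp only [h, Finset.sum_const, Finset.card_univ, Fintype.card_fin, nsmul_eq_mul]
  rw [← mul_assoc, mul_inv_cancel₀ hd'.ne', one_mul, Real.log_inv, neg_neg]

/-- A Schmidt vector that has one coefficient `t` is close to the maximally entangled one. -/
theorem exists_schmidt_near_uniform {n : ℕ} (hn : 0 < n) {t : ℝ} (ht : 0 ≤ t) (ht1 : t ≤ 1)
    (hnt : ((n + 1 : ℕ) : ℝ)⁻¹ ≤ t ^ 2) :
    ∃ x : Fin (n + 1) → ℝ, x 0 = t ∧ ∑ i, x i ^ 2 = 1 ∧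
      ∑ i, (x i - (√((n + 1 : ℕ) : ℝ))⁻¹) ^ 2 ≤ 2 * t ^ 2 := by
  have hn' : (0 : ℝ) < n := by exact_mod_cast hn
  set u : ℝ := (√((n + 1 : ℕ) : ℝ))⁻¹ with hu
  have hu0 : 0 ≤ u := by positivity
  have hu2 : u ^ 2 = ((n + 1 : ℕ) : ℝ)⁻¹ := by
    rw [hu, inv_pow, Real.sq_sqrt (by positivity)]
  have hnu : (n : ℝ) * u ^ 2 = 1 - u ^ 2 := by
    rw [hu2]; push_cast; field_simp; ring
  have ht2 : 0 ≤ 1 - t ^ 2 := by nlinarith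
  -- The common value of the other `n` coefficients, fixed by normalization.
  set y : ℝ := √((1 - t ^ 2) / n) with hy
  have hy0 : 0 ≤ y := Real.sqrt_nonneg _
  have hy2 : n * y ^ 2 = 1 - t ^ 2 := by
    rw [hy, Real.sq_sqrt (by positivity)]; field_simp
  refine ⟨Fin.cons t fun _ => y, rfl, ?_, ?_⟩
  · simp [Fin.sum_univ_succ, hy2]
  · simp only [Fin.sum_univ_succ, Fin.cons_zero, Fin.cons_succ, Finset.sum_const,
      Finset.card_univ, Fintype.card_fin, nsmul_eq_mul]
    rw [← hu2] at hnt
    have hut : u ≤ t := (sq_le_sq₀ hu0 ht).1 hnt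
    have hyu : y ≤ u := by
      refine (sq_le_sq₀ hy0 hu0).1 ?_
      nlinarith
    have h1 : (t - u) ^ 2 ≤ t ^ 2 := by nlinarith
    -- Since `0 ≤ y ≤ u`, `(y - u)² ≤ u² - y²`; by normalization `n (u² - y²) = t² - u²`, so the
    -- total is at most `2 t²`.
    have h2 : n * (y - u) ^ 2 ≤ n * u ^ 2 - n * y ^ 2 := by
      have : (y - u) ^ 2 ≤ u ^ 2 - y ^ 2 := by nlinarith
      nlinarith
    nlinarith [sq_nonneg u]

end Schmidt

/-! ### The hard pair and the lower bound. -/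

theorem exists_low_high_pair {d : ℕ} {a : ℝ} (ha : 0 < a) (had : a ≤ Real.log d) :
    ∃ (ψ φ : EuclideanSpace ℂ (Fin d × Fin d)), ‖ψ‖ = 1 ∧ ‖φ‖ = 1 ∧
      renyiTwo ψ ≤ a ∧ renyiTwo φ = Real.log d ∧ ‖ψ - φ‖ ^ 2 ≤ 2 * Real.exp (-(a / 4)) ^ 2 := by
  have hd1 : 1 < d := by
    by_contra h
    have : d = 0 ∨ d = 1 := by omega
    -- `Real.log 0 = 0` as well as `Real.log 1 = 0`, so both cases contradict `0 < a`.
    rcases this with rfl | rfl <;> simp at had <;> linarith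
  obtain ⟨n, rfl⟩ : ∃ n, d = n + 1 := ⟨d - 1, by omega⟩
  have hd0 : (0 : ℝ) < ((n + 1 : ℕ) : ℝ) := by positivity
  have hexp : ∀ k : ℕ, Real.exp (-(a / 4)) ^ k = Real.exp (-(k * a / 4)) := by
    intro k
    rw [← Real.exp_nat_mul]; ring_nf
  -- `1/d ≤ exp (-a) ≤ exp (-a/2)`: the raised coefficient is at least the uniform one.
  have hnt : ((n + 1 : ℕ) : ℝ)⁻¹ ≤ Real.exp (-(a / 4)) ^ 2 := by
    rw [hexp, ← Real.exp_log hd0, ← Real.exp_neg]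
    refine Real.exp_le_exp.2 ?_
    push_cast at had ⊢
    linarith
  obtain ⟨x, hx0, hx1, hx2⟩ := exists_schmidt_near_uniform (by omega) (Real.exp_pos _).le
    (Real.exp_le_one_iff.2 (by linarith)) hnt
  refine ⟨diagonalState x, diagonalState fun _ => (√((n + 1 : ℕ) : ℝ))⁻¹, ?_, ?_, ?_,
    renyiTwo_maximallyEntangled (by omega), ?_⟩
  · rw [← sq_eq_sq₀ (norm_nonneg _) zero_le_one, norm_sq_diagonalState, hx1, one_pow]
  · rw [← sq_eq_sq₀ (norm_nonneg _) zero_le_one, norm_sq_diagonalState, Finset.sum_const,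
      Finset.card_univ, Fintype.card_fin, nsmul_eq_mul, inv_pow, Real.sq_sqrt hd0.le,
      mul_inv_cancel₀ hd0.ne', one_pow]
  · have h : Real.exp (-a) ≤ ∑ i, x i ^ 4 := by
      have h1 : x 0 ^ 4 ≤ ∑ i, x i ^ 4 :=
        Finset.single_le_sum (f := fun i => x i ^ 4) (fun i _ => by positivity)
          (Finset.mem_univ 0)
      rw [hx0, hexp] at h1
      convert h1 using 2
      push_cast
      ring
    have h2 := Real.log_le_log (Real.exp_pos _) h
    rw [Real.log_exp] at h2
    rw [renyiTwo_diagonalState]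
    linarith
  · rw [diagonalState_sub, norm_sq_diagonalState]
    exact hx2

end UnitaryTesting

end

open UnitaryTesting in
theorem mainTheorem6 :
    ∃ c : ℝ, 0 < c ∧
      ∀ (d : ℕ) (a b : ℝ) (_ : 5 ≤ a) (hab : a < b) (_ : b ≤ Real.log (d : ℝ))
        (T : ℕ) (A : UnitaryTesting.QueryAlgorithm (Fin d × Fin d) T),
        (A.IsTester (UnitaryTesting.entanglementEntropyProblem d a b hab) ∨
          A.IsTester (UnitaryTesting.entanglementEntropyProblem d a b hab).swap) →
        c * Real.exp (a / 4) ≤ (T : ℝ) := by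
  -- With `√2` rounded up to 2, `1/3 ≤ 2 · T · 4 · 2 exp (-a/4)`, which gives `1/48`.
  refine ⟨1 / 48, by norm_num, fun d a b ha hab hb T A hA => ?_⟩
  obtain ⟨ψ, φ, hψ, hφ, hlow, hhigh, hdist⟩ :=
    exists_low_high_pair (d := d) (a := a) (by linarith) (by linarith)
  have hT : (0 : ℝ) ≤ T := T.cast_nonneg
  have hy : reflection ψ hψ ∈ (entanglementEntropyProblem d a b hab).yes :=
    ⟨ψ, hψ, hlow, rfl⟩
  have hn : reflection φ hφ ∈ (entanglementEntropyProblem d a b hab).no :=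
    ⟨φ, hφ, hhigh.symm ▸ hb, rfl⟩
  have hbias : 1 / 3 ≤ 2 * (T * (4 * ‖ψ - φ‖)) := by
    rcases hA with h | h
    · have h1 := h.1 _ hy
      have h2 := h.2 _ hn
      have h3 := A.acceptProb_sub_le (reflection ψ hψ) (reflection φ hφ)
      have h4 := mul_le_mul_of_nonneg_left (norm_reflection_sub_le ψ φ hψ hφ) hT
      linarith
    · have h1 := h.1 _ hn
      have h2 := h.2 _ hy
      have h3 := A.acceptProb_sub_le (reflection φ hφ) (reflection ψ hψ)
      have h4 := mul_le_mul_of_nonneg_left (norm_reflection_sub_le φ ψ hφ hψ) hT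
      rw [norm_sub_rev φ ψ] at h4
      linarith
  have hle : ‖ψ - φ‖ ≤ 2 * Real.exp (-(a / 4)) := by
    refine (sq_le_sq₀ (norm_nonneg _) (by positivity)).1 ?_
    nlinarith [sq_nonneg (Real.exp (-(a / 4)))]
  have h5 := mul_le_mul_of_nonneg_left hle hT
  have h6 : 1 / 48 ≤ T * Real.exp (-(a / 4)) := by linarith
  have h7 := mul_le_mul_of_nonneg_right h6 (Real.exp_pos (a / 4)).le
  rwa [mul_assoc, ← Real.exp_add, neg_add_cancel, Real.exp_zero, mul_one] at h7
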